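/- Let $\varphi=(1+\sqrt5)/2$, and let $x_F=x_1x_2x_3\cdots=0100101001001\cdots$ be the infinite Fibonacci word, i.e. the iterative fixed point of the morphism $0\mapsto 01$, $1\mapsto 0$. Let $w$ be any finite word that occurs in $x_F$. Then $w$ occurs infinitely often in $x_F$; let $Y(1)<Y(2)<Y(3)<\cdots$ be all the positions of its occurrences, i.e. all $k\ge 1$ with $x_kx_{k+1}\cdots x_{k+|w|-1}=w$. Write $x_F=r_0(w)\,r_1(w)\,r_2(w)\cdots$, where $r_0(w)=x_1\cdots x_{Y(1)-1}$ is the (possibly empty) prefix before the first occurrence of $w$ and, for $i\ge1$, $r_i(w)=x_{Y(i)}\cdots x_{Y(i+1)-1}$ is the $i$-th return word of $w$. Put $l_1=|r_1(w)|$ and $l_2=|r_2(w)|$. Then $Y$ is a generalized Beatty sequence: for all $n\ge 1$, $$Y(n)=p\lfloor n\varphi\rfloor+qn+r,\qquad p=l_1-l_2,\quad q=2l_2-l_1,\quad r=|r_0(w)|+1-l_2 .$$ -/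

import Mathlib

namespace FibReturn

/-- The Fibonacci morphism `0 ↦ 01`, `1 ↦ 0` on letters. -/
def morphismLetter (a : Fin 2) : List (Fin 2) :=
  if a = 0 then [0, 1] else [0]

/-- The Fibonacci morphism on finite words. -/
def morphism (u : List (Fin 2)) : List (Fin 2) :=
  u.flatMap morphismLetter

/-- The `k`-th iterate of the Fibonacci morphism, applied to the word `0`. -/
def iter (k : ℕ) : List (Fin 2) :=
  morphism^[k] [0]

/-- The letter at position `k ≥ 1` of the infinite Fibonacci word `x₁ x₂ x₃ … = 0100101001001…`,
the iterative fixed point of the morphism: it is read off from the `k`-th iterate, which has at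
least `k` letters (`le_length_iter`) and is a prefix of all later iterates (`iter_prefix`).
Position `0` is not used. -/
def fibWord (k : ℕ) : Fin 2 :=
  (iter k).getD (k - 1) 0

theorem morphism_append (u v : List (Fin 2)) : morphism (u ++ v) = morphism u ++ morphism v := by
  simp [morphism]

theorem iter_succ (k : ℕ) : iter (k + 1) = morphism (iter k) := by
  simp [iter, Function.iterate_succ_apply']

theorem iter_add_two (k : ℕ) : iter (k + 2) = iter (k + 1) ++ iter k := by
  induction k with
  | zero => decide
  | succ k ih =>
    rw [iter_succ (k + 2), ih, morphism_append, ← iter_succ, ← iter_succ, ih]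

theorem iter_prefix (k : ℕ) : iter k <+: iter (k + 1) := by
  cases k with
  | zero => decide
  | succ k => rw [iter_add_two]; exact List.prefix_append _ _

theorem le_length_iter (k : ℕ) : k + 1 ≤ (iter k).length := by
  induction k using Nat.strong_induction_on with
  | _ k ih =>
    match k, ih with
    | 0, _ => decide
    | 1, _ => decide
    | k + 2, ih =>
      have h1 := ih (k + 1) (by omega)
      have h2 := ih k (by omega)
      rw [iter_add_two, List.length_append]
      omega

/-- The factor `x_k x_{k+1} … x_{k+m-1}` of length `m` of the Fibonacci word. -/
def factor (k m : ℕ) : List (Fin 2) :=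
  (List.range m).map fun i => fibWord (k + i)

/-- The word `w` occurs in the Fibonacci word at position `k`, where `k ≥ 1`. -/
def OccursAt (w : List (Fin 2)) (k : ℕ) : Prop :=
  1 ≤ k ∧ factor k w.length = w

/-- The Fibonacci language: all finite words that occur in the Fibonacci word. -/
def language : Set (List (Fin 2)) :=
  {w | ∃ k, OccursAt w k}

/-- The position `Y(n)` of the `n`-th occurrence of `w` in the Fibonacci word, `n = 1, 2, 3, …`,
in increasing order (meaningful as long as there are at least `n` occurrences). -/
noncomputable def position (w : List (Fin 2)) (n : ℕ) : ℕ :=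
  Nat.nth (OccursAt w) (n - 1)

/-- The return sequence `r₀(w), r₁(w), r₂(w), …` of `w`: the word `r₀(w)` is the prefix of the
Fibonacci word that precedes the first occurrence of `w`, and for `n ≥ 1` the word `rₙ(w)` is the
return word that extends from the beginning of the `n`-th occurrence of `w` up to, and not
including, the beginning of the next one. -/
noncomputable def returnWord (w : List (Fin 2)) : ℕ → List (Fin 2)
  | 0 => factor 1 (position w 1 - 1)
  | n + 1 => factor (position w (n + 1)) (position w (n + 2) - position w (n + 1))

/-- `(V(n))_{n ≥ 1}` is the generalized Beatty sequence `p ⌊n α⌋ + q n + r`. -/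
def IsGeneralizedBeatty (α : ℝ) (p q r : ℤ) (V : ℕ → ℤ) : Prop :=
  ∀ n : ℕ, 1 ≤ n → V n = p * ⌊(n : ℝ) * α⌋ + q * (n : ℤ) + r

end FibReturn

/-!
The Fibonacci word is the concatenation of the images `σ(x₁) σ(x₂) ⋯` of its own letters, and the
image of its `n`-th letter begins at position `⌊nφ⌋`. Extending words to the left one letter at a
time shows that the occurrences of any word are obtained from the set of all positions by repeatedly
applying "pass to the first letter of the image" and, on zeros only, "pass to the second letter of
the image". Both operations turn an enumeration that is affine in `n` and the number of zeros before
the `n`-th letter into another such enumeration, provided one also keeps track of the number of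
zeros before its terms. As that number of zeros is `⌊nφ⌋ - n`, every `Y` is a generalized Beatty
sequence, and its coefficients can be read off from `Y(1)`, `Y(2)`, `Y(3)`.
-/

namespace FibReturn

theorem length_factor (k m : ℕ) : (factor k m).length = m := by
  simp [factor]

theorem factor_add (k m l : ℕ) : factor k (m + l) = factor k m ++ factor (k + m) l := by
  simp [factor, List.range_add, Nat.add_assoc]

theorem factor_succ (k m : ℕ) : factor k (m + 1) = fibWord k :: factor (k + 1) m := by
  rw [Nat.add_comm m, factor_add]
  simp [factor]

theorem iter_prefix_of_le {k m : ℕ} (h : k ≤ m) : iter k <+: iter m := by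
  induction m, h using Nat.le_induction with
  | base => exact List.prefix_rfl
  | succ m _ ih => exact ih.trans (iter_prefix m)

theorem getElem_iter {k j : ℕ} (h : j < (iter k).length) : (iter k)[j] = fibWord (j + 1) := by
  have hj : j < (iter (j + 1)).length := by have := le_length_iter (j + 1); omega
  have hword : fibWord (j + 1) = (iter (j + 1))[j] := by simp [fibWord, hj]
  rw [hword]
  rcases le_total k (j + 1) with hk | hk
  · exact (iter_prefix_of_le hk).getElem h
  · exact ((iter_prefix_of_le hk).getElem hj).symm

theorem take_iter {k n : ℕ} (h : n ≤ (iter k).length) : (iter k).take n = factor 1 n := by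
  refine List.ext_getElem (by simp [length_factor, h]) fun j _ _ => ?_
  simp [getElem_iter, factor, Nat.add_comm]

theorem morphism_factor_one (n : ℕ) :
    morphism (factor 1 n) = factor 1 (morphism (factor 1 n)).length := by
  have hn : n ≤ (iter n).length := (Nat.le_succ n).trans (le_length_iter n)
  have hprefix : morphism (factor 1 n) <+: iter (n + 1) := by
    rw [iter_succ, ← take_iter hn]
    conv_rhs => rw [← List.take_append_drop n (iter n), morphism_append]
    exact List.prefix_append _ _
  rw [← take_iter hprefix.length_le]
  exact List.prefix_iff_eq_take.1 hprefix

theorem length_morphism (u : List (Fin 2)) : (morphism u).length = u.length + u.count 0 := by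
  induction u with
  | nil => rfl
  | cons a u ih =>
    change (morphismLetter a ++ morphism u).length = _
    fin_cases a <;> simp [morphismLetter, ih] <;> omega

theorem count_zero_morphism (u : List (Fin 2)) : (morphism u).count 0 = u.length := by
  induction u with
  | nil => rfl
  | cons a u ih =>
    change (morphismLetter a ++ morphism u).count 0 = _
    fin_cases a <;> simp [morphismLetter, ih]

/-- The number of zeros among the first `n` letters of the Fibonacci word. -/
def zeros (n : ℕ) : ℕ :=
  (factor 1 n).count 0

/-- The number of letters that precede the block `morphismLetter (fibWord (n + 1))` when the
Fibonacci word is cut into the images of its own letters. -/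
def blockStart (n : ℕ) : ℕ :=
  (morphism (factor 1 n)).length

theorem blockStart_eq (n : ℕ) : blockStart n = n + zeros n := by
  rw [blockStart, length_morphism, length_factor, zeros]

theorem zeros_blockStart (n : ℕ) : zeros (blockStart n) = n := by
  rw [zeros, blockStart, ← morphism_factor_one, count_zero_morphism, length_factor]

theorem morphism_factor_one_succ (n : ℕ) :
    morphism (factor 1 (n + 1)) = morphism (factor 1 n) ++ morphismLetter (fibWord (n + 1)) := by
  rw [factor_add, morphism_append, Nat.add_comm 1 n]
  simp [factor, morphism]

theorem blockStart_succ (n : ℕ) :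
    blockStart (n + 1) = blockStart n + (morphismLetter (fibWord (n + 1))).length := by
  rw [blockStart, morphism_factor_one_succ, List.length_append, blockStart]

theorem morphismLetter_fibWord (n : ℕ) :
    morphismLetter (fibWord (n + 1)) =
      factor (1 + blockStart n) (morphismLetter (fibWord (n + 1))).length := by
  apply List.append_cancel_left (as := morphism (factor 1 n))
  rw [← morphism_factor_one_succ, morphism_factor_one (n + 1), ← blockStart, blockStart_succ,
    factor_add, morphism_factor_one n, ← blockStart]

theorem fibWord_eq_zero_or_one (k : ℕ) : fibWord k = 0 ∨ fibWord k = 1 := by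
  omega

theorem fibWord_blockStart (n : ℕ) : fibWord (blockStart n + 1) = 0 := by
  have hblock := morphismLetter_fibWord n
  rcases fibWord_eq_zero_or_one (n + 1) with hn | hn <;>
    simp_all [morphismLetter, factor, Nat.add_comm, List.range_succ]

theorem fibWord_blockStart_add_one {n : ℕ} (hn : fibWord (n + 1) = 0) :
    fibWord (blockStart n + 1 + 1) = 1 := by
  have hblock := morphismLetter_fibWord n
  simp only [hn, morphismLetter] at hblock
  have hsecond := congrArg (·[1]?) hblock
  simpa [factor, add_right_comm, Nat.add_comm 1, eq_comm] using hsecond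

theorem zeros_blockStart_add_one (n : ℕ) : zeros (blockStart n + 1) = n + 1 := by
  rw [zeros, factor_add, List.count_append, ← zeros, zeros_blockStart]
  simp [factor, Nat.add_comm, fibWord_blockStart]

theorem blockStart_succ_of_eq_zero {n : ℕ} (hn : fibWord (n + 1) = 0) :
    blockStart (n + 1) = blockStart n + 2 := by
  rw [blockStart_succ, hn]; rfl

theorem blockStart_succ_of_eq_one {n : ℕ} (hn : fibWord (n + 1) = 1) :
    blockStart (n + 1) = blockStart n + 1 := by
  rw [blockStart_succ, hn]; rfl

theorem blockStart_strictMono : StrictMono blockStart := by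
  refine strictMono_nat_of_lt_succ fun n => ?_
  rcases fibWord_eq_zero_or_one (n + 1) with hn | hn
  · rw [blockStart_succ_of_eq_zero hn]; omega
  · rw [blockStart_succ_of_eq_one hn]; omega

theorem lt_blockStart {n : ℕ} (hn : 0 < n) : n < blockStart n := by
  induction n, hn using Nat.le_induction with
  | base => decide
  | succ n _ ih => exact (Nat.succ_le_of_lt ih).trans_lt (blockStart_strictMono n.lt_succ_self)

theorem exists_eq_blockStart_or (k : ℕ) :
    (∃ i, k = blockStart i) ∨ ∃ i, fibWord (i + 1) = 0 ∧ k = blockStart i + 1 := by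
  induction k with
  | zero => exact .inl ⟨0, rfl⟩
  | succ k ih =>
    obtain ⟨i, rfl⟩ | ⟨i, hi, rfl⟩ := ih
    · rcases fibWord_eq_zero_or_one (i + 1) with hi | hi
      · exact .inr ⟨i, hi, rfl⟩
      · exact .inl ⟨i + 1, (blockStart_succ_of_eq_one hi).symm⟩
    · exact .inl ⟨i + 1, (blockStart_succ_of_eq_zero hi).symm⟩

theorem fibWord_succ_eq_zero_iff {k : ℕ} : fibWord (k + 1) = 0 ↔ ∃ i, k = blockStart i := by
  refine ⟨fun hk => (exists_eq_blockStart_or k).resolve_right ?_, ?_⟩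
  · rintro ⟨i, hi, rfl⟩
    simp [fibWord_blockStart_add_one hi] at hk
  · rintro ⟨i, rfl⟩
    exact fibWord_blockStart i

theorem fibWord_succ_eq_one_iff {k : ℕ} :
    fibWord (k + 1) = 1 ↔ ∃ i, fibWord (i + 1) = 0 ∧ k = blockStart i + 1 := by
  refine ⟨fun hk => (exists_eq_blockStart_or k).resolve_left ?_, ?_⟩
  · rintro ⟨i, rfl⟩
    simp [fibWord_blockStart] at hk
  · rintro ⟨i, hi, rfl⟩
    exact fibWord_blockStart_add_one hi

section Wythoff

open scoped goldenRatio

theorem mul_goldenRatio_mul_goldenRatio_sub_one (x : ℝ) : x * φ * (φ - 1) = x := by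
  linear_combination x * Real.goldenRatio_sq

theorem floor_floor_mul_goldenRatio {m : ℤ} (hm : m ≠ 0) :
    ⌊(⌊m * φ⌋ : ℝ) * φ⌋ = ⌊m * φ⌋ + m - 1 := by
  have hφ : 0 < φ - 1 := sub_pos.2 Real.one_lt_goldenRatio
  have hirr : (⌊m * φ⌋ : ℝ) ≠ m * φ :=
    ((Real.goldenRatio_irrational.intCast_mul hm).ne_int _).symm
  have hlower := mul_lt_mul_of_pos_right ((Int.floor_le _).lt_of_ne hirr) hφ
  have hupper := mul_lt_mul_of_pos_right (Int.lt_floor_add_one (m * φ)) hφ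
  rw [mul_goldenRatio_mul_goldenRatio_sub_one] at hlower hupper
  rw [Int.floor_eq_iff]
  push_cast
  constructor <;> linarith [Real.goldenRatio_lt_two]

theorem floor_floor_mul_goldenRatio_add_one (m : ℤ) :
    ⌊((⌊m * φ⌋ : ℝ) + 1) * φ⌋ = ⌊m * φ⌋ + m + 1 := by
  have hφ : 0 < φ - 1 := sub_pos.2 Real.one_lt_goldenRatio
  have hlower := mul_le_mul_of_nonneg_right (Int.floor_le (m * φ)) hφ.le
  have hupper := mul_lt_mul_of_pos_right (Int.lt_floor_add_one (m * φ)) hφ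
  rw [mul_goldenRatio_mul_goldenRatio_sub_one] at hlower hupper
  rw [Int.floor_eq_iff]
  push_cast
  constructor <;> linarith [Real.goldenRatio_lt_two]

theorem floor_succ_mul_goldenRatio (n : ℕ) : ⌊((n : ℝ) + 1) * φ⌋ = n + 1 + zeros n := by
  induction n using Nat.strong_induction_on with
  | _ n ih =>
    have hfloor {i : ℕ} (hi : i < n) : ⌊((i + 1 : ℤ) : ℝ) * φ⌋ = blockStart i + 1 := by
      push_cast
      rw [ih i hi, blockStart_eq]
      push_cast
      ring
    obtain ⟨i, rfl⟩ | ⟨i, -, rfl⟩ := exists_eq_blockStart_or n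
    · rcases i.eq_zero_or_pos with rfl | hpos
      · rw [zeros_blockStart, Int.floor_eq_iff]
        have hzero : blockStart 0 = 0 := rfl
        rw [hzero]
        push_cast
        constructor <;> linarith [Real.one_lt_goldenRatio, Real.goldenRatio_lt_two]
      · have hnested := floor_floor_mul_goldenRatio (m := i + 1) (by omega)
        rw [hfloor (lt_blockStart hpos)] at hnested
        rw [zeros_blockStart]
        push_cast at hnested
        linarith
    · have hnested := floor_floor_mul_goldenRatio_add_one (i + 1)
      rw [hfloor (Nat.lt_succ_of_le (blockStart_strictMono.le_apply))] at hnested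
      rw [zeros_blockStart_add_one]
      push_cast at hnested ⊢
      linarith

end Wythoff

/-- The offsets from which the letter `a` can be read, followed by an offset in `S`: if `S` consists
of the offsets of the occurrences of a word `w`, then `leftExtension a S` does so for `a :: w`. -/
def leftExtension (a : Fin 2) (S : Set ℕ) : Set ℕ :=
  {k | fibWord (k + 1) = a ∧ k + 1 ∈ S}

theorem leftExtension_zero (S : Set ℕ) :
    leftExtension 0 S = blockStart '' {i | blockStart i + 1 ∈ S} := by
  ext k
  simp only [leftExtension, fibWord_succ_eq_zero_iff, Set.mem_ofPred_eq, Set.mem_image]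
  grind

theorem leftExtension_one (S : Set ℕ) :
    leftExtension 1 S =
      (blockStart · + 1) '' {i | fibWord (i + 1) = 0 ∧ blockStart (i + 1) ∈ S} := by
  ext k
  simp only [leftExtension, fibWord_succ_eq_one_iff, Set.mem_ofPred_eq, Set.mem_image]
  grind [blockStart_succ_of_eq_zero]

theorem blockStart_mem_image {i : ℕ} {S : Set ℕ} : blockStart i ∈ blockStart '' S ↔ i ∈ S :=
  blockStart_strictMono.injective.mem_set_image

theorem blockStart_add_one_ne {i j : ℕ} (hi : fibWord (i + 1) = 0) :
    blockStart i + 1 ≠ blockStart j := by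
  intro hij
  have hzero := fibWord_blockStart j
  simp [← hij, fibWord_blockStart_add_one hi] at hzero

theorem blockStart_add_one_mem_image {i : ℕ} {S : Set ℕ} :
    blockStart i + 1 ∈ blockStart '' S ↔ i ∈ leftExtension 1 S := by
  rcases fibWord_eq_zero_or_one (i + 1) with hi | hi
  · have hnotMem : blockStart i + 1 ∉ blockStart '' S :=
      fun ⟨_, _, hj⟩ => blockStart_add_one_ne hi hj.symm
    simp [hnotMem, leftExtension, hi]
  · rw [← blockStart_succ_of_eq_one hi, blockStart_mem_image]
    simp [leftExtension, hi]

theorem leftExtension_zero_univ : leftExtension 0 Set.univ = blockStart '' Set.univ := by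
  simp [leftExtension_zero]

theorem leftExtension_one_univ :
    leftExtension 1 Set.univ = (blockStart · + 1) '' leftExtension 0 Set.univ := by
  rw [leftExtension_one]
  rfl

theorem leftExtension_zero_image_blockStart (S : Set ℕ) :
    leftExtension 0 (blockStart '' S) = blockStart '' leftExtension 1 S := by
  simp only [leftExtension_zero, blockStart_add_one_mem_image, Set.ofPred_mem_eq]

theorem leftExtension_one_image_blockStart (S : Set ℕ) :
    leftExtension 1 (blockStart '' S) = (blockStart · + 1) '' leftExtension 0 S := by
  simp only [leftExtension_one, blockStart_mem_image]
  rfl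

theorem leftExtension_zero_image_blockStart_add_one (S : Set ℕ) :
    leftExtension 0 ((blockStart · + 1) '' S) = blockStart '' S := by
  simp [leftExtension_zero, blockStart_strictMono.injective.eq_iff]

theorem leftExtension_one_image_blockStart_add_one {S : Set ℕ}
    (hS : ∀ i ∈ S, fibWord (i + 1) = 0) :
    leftExtension 1 ((blockStart · + 1) '' S) = ∅ := by
  rw [leftExtension_one, Set.image_eq_empty, Set.eq_empty_iff_forall_notMem]
  rintro i ⟨-, j, hj, hji⟩
  exact blockStart_add_one_ne (hS j hj) hji

/-- The sets of offsets obtained from the set of all offsets by repeated substitution: a set of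
letters is replaced by the first letters of their images under the morphism or, if all of them are
zeros, by the second letters of their images `01`. The offsets of the occurrences of a word form
such a set (`isCylinder_offsets`). -/
inductive IsCylinder : Set ℕ → Prop
  | univ : IsCylinder Set.univ
  | image_blockStart {S : Set ℕ} : IsCylinder S → IsCylinder (blockStart '' S)
  | image_blockStart_add_one {S : Set ℕ} : IsCylinder S → (∀ i ∈ S, fibWord (i + 1) = 0) →
      IsCylinder ((blockStart · + 1) '' S)

theorem IsCylinder.leftExtension {S : Set ℕ} (hS : IsCylinder S) (a : Fin 2)
    (hne : (leftExtension a S).Nonempty) : IsCylinder (leftExtension a S) := by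
  induction hS generalizing a with
  | univ =>
    have hzero : IsCylinder (FibReturn.leftExtension 0 Set.univ) :=
      leftExtension_zero_univ ▸ univ.image_blockStart
    fin_cases a
    · exact hzero
    · exact leftExtension_one_univ ▸ hzero.image_blockStart_add_one fun _ hi => hi.1
  | @image_blockStart S _ ih =>
    fin_cases a
    · simp only [Fin.zero_eta, leftExtension_zero_image_blockStart, Set.image_nonempty] at hne ⊢
      exact (ih 1 hne).image_blockStart
    · simp only [Fin.mk_one, leftExtension_one_image_blockStart, Set.image_nonempty] at hne ⊢
      exact (ih 0 hne).image_blockStart_add_one fun _ hi => hi.1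
  | @image_blockStart_add_one S hS hzeros _ =>
    fin_cases a
    · exact leftExtension_zero_image_blockStart_add_one S ▸ hS.image_blockStart
    · simp [leftExtension_one_image_blockStart_add_one hzeros] at hne

/-- The offsets of the occurrences of `w`: an occurrence at position `k + 1` has offset `k`, the
number of letters that precede it. -/
def offsets (w : List (Fin 2)) : Set ℕ :=
  {k | OccursAt w (k + 1)}

theorem offsets_nil : offsets [] = Set.univ := by
  simp [offsets, OccursAt, factor]

theorem offsets_cons (a : Fin 2) (w : List (Fin 2)) :
    offsets (a :: w) = leftExtension a (offsets w) := by
  ext k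
  simp [offsets, leftExtension, OccursAt, factor_succ]

theorem isCylinder_offsets {w : List (Fin 2)} (hw : (offsets w).Nonempty) :
    IsCylinder (offsets w) := by
  induction w with
  | nil => exact offsets_nil ▸ IsCylinder.univ
  | cons a w ih =>
    rw [offsets_cons] at hw ⊢
    obtain ⟨k, hk⟩ := hw
    exact (ih ⟨k + 1, hk.2⟩).leftExtension a ⟨k, hk⟩

/-- The sequences `n ↦ a + b * n + c * zeros n` with coefficients in `ℕ`: these are the form in
which generalized Beatty sequences arise here, indexed from `0`. -/
def zerosAffine : Submodule ℕ (ℕ → ℕ) :=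
  Submodule.span ℕ {1, id, zeros}

theorem one_mem_zerosAffine : 1 ∈ zerosAffine :=
  Submodule.subset_span (by simp)

theorem id_mem_zerosAffine : id ∈ zerosAffine :=
  Submodule.subset_span (by simp)

theorem zeros_mem_zerosAffine : zeros ∈ zerosAffine :=
  Submodule.subset_span (by simp)

theorem IsCylinder.exists_strictMono {S : Set ℕ} (hS : IsCylinder S) :
    ∃ Y : ℕ → ℕ, StrictMono Y ∧ Set.range Y = S ∧ Y ∈ zerosAffine ∧ zeros ∘ Y ∈ zerosAffine := by
  induction hS with
  | univ =>
    exact ⟨id, strictMono_id, Set.range_id, id_mem_zerosAffine, zeros_mem_zerosAffine⟩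
  | image_blockStart _ ih =>
    obtain ⟨Y, hmono, rfl, hY, hzeros⟩ := ih
    refine ⟨blockStart ∘ Y, blockStart_strictMono.comp hmono, Set.range_comp .., ?_, ?_⟩
    · have hsum : blockStart ∘ Y = Y + zeros ∘ Y := funext fun n => blockStart_eq (Y n)
      exact hsum ▸ add_mem hY hzeros
    · have hcancel : zeros ∘ blockStart ∘ Y = Y := funext fun n => zeros_blockStart (Y n)
      rwa [hcancel]
  | image_blockStart_add_one _ _ ih =>
    obtain ⟨Y, hmono, rfl, hY, hzeros⟩ := ih
    refine ⟨(blockStart · + 1) ∘ Y, (blockStart_strictMono.add_const 1).comp hmono,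
      Set.range_comp .., ?_, ?_⟩
    · have hsum : (blockStart · + 1) ∘ Y = Y + zeros ∘ Y + 1 :=
        funext fun n => congrArg (· + 1) (blockStart_eq (Y n))
      exact hsum ▸ add_mem (add_mem hY hzeros) one_mem_zerosAffine
    · have hcancel : zeros ∘ (blockStart · + 1) ∘ Y = Y + 1 :=
        funext fun n => zeros_blockStart_add_one (Y n)
      exact hcancel ▸ add_mem hY one_mem_zerosAffine

theorem exists_strictMono_range_eq_setOf_occursAt {w : List (Fin 2)} (hw : w ∈ language) :
    ∃ Y ∈ zerosAffine, StrictMono Y ∧ Set.range Y = {k | OccursAt w k} := by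
  have hoffsets : (offsets w).Nonempty := by
    obtain ⟨k, hk⟩ := hw
    obtain ⟨j, rfl⟩ := Nat.exists_eq_add_of_le' hk.1
    exact ⟨j, hk⟩
  obtain ⟨Y, hmono, hrange, hY, -⟩ := (isCylinder_offsets hoffsets).exists_strictMono
  refine ⟨Y + 1, add_mem hY one_mem_zerosAffine, hmono.add_const 1, Set.ext fun k => ?_⟩
  cases k with
  | zero => simp [OccursAt]
  | succ k => simpa [offsets] using Set.ext_iff.1 hrange k

theorem nth_eq_of_strictMono {P : ℕ → Prop} {Y : ℕ → ℕ} (hY : StrictMono Y)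
    (hrange : Set.range Y = {k | P k}) : Nat.nth P = Y := by
  have hinf : {k | P k}.Infinite := hrange ▸ Set.infinite_range_of_injective hY.injective
  have hnth : Set.range (Nat.nth P) = {k | P k} := Nat.range_nth_of_infinite hinf
  exact ((Nat.nth_strictMono hinf).range_inj hY).1 (hnth.trans hrange.symm)

theorem infinite_setOf_occursAt {w : List (Fin 2)} (hw : w ∈ language) :
    {k | OccursAt w k}.Infinite := by
  obtain ⟨Y, -, hmono, hrange⟩ := exists_strictMono_range_eq_setOf_occursAt hw
  exact hrange ▸ Set.infinite_range_of_injective hmono.injective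

theorem exists_isGeneralizedBeatty_of_mem_zerosAffine {Y : ℕ → ℕ} (hY : Y ∈ zerosAffine) :
    ∃ p q r : ℤ, IsGeneralizedBeatty Real.goldenRatio p q r fun n => (Y (n - 1) : ℤ) := by
  obtain ⟨a, b, c, rfl⟩ := Submodule.mem_span_triple.1 hY
  refine ⟨c, b - c, a - b, fun n hn => ?_⟩
  obtain ⟨n, rfl⟩ := Nat.exists_eq_add_of_le' hn
  simp only [Pi.add_apply, Pi.smul_apply, Pi.one_apply, smul_eq_mul, id_eq, Nat.add_sub_cancel]
  push_cast
  rw [floor_succ_mul_goldenRatio]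
  ring

theorem exists_isGeneralizedBeatty_position {w : List (Fin 2)} (hw : w ∈ language) :
    ∃ p q r : ℤ, IsGeneralizedBeatty Real.goldenRatio p q r fun n => (position w n : ℤ) := by
  obtain ⟨Y, hY, hmono, hrange⟩ := exists_strictMono_range_eq_setOf_occursAt hw
  simpa only [position, nth_eq_of_strictMono hmono hrange] using
    exists_isGeneralizedBeatty_of_mem_zerosAffine hY

theorem IsGeneralizedBeatty.coefficients_eq {p q r : ℤ} {V : ℕ → ℤ}
    (hV : IsGeneralizedBeatty Real.goldenRatio p q r V) :
    p = (V 2 - V 1) - (V 3 - V 2) ∧ q = 2 * (V 3 - V 2) - (V 2 - V 1) ∧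
      r = V 1 - (V 3 - V 2) := by
  have hVsucc (n : ℕ) : V (n + 1) = p * (n + 1 + zeros n) + q * (n + 1) + r := by
    have hn := hV (n + 1) n.succ_pos
    push_cast at hn
    rwa [floor_succ_mul_goldenRatio] at hn
  have h1 : V 1 = p + q + r := by simpa [zeros, factor] using hVsucc 0
  have h2 : V 2 = p * 3 + q * 2 + r := hVsucc 1
  have h3 : V 3 = p * 4 + q * 3 + r := hVsucc 2
  refine ⟨?_, ?_, ?_⟩ <;> linarith

theorem length_returnWord_zero {w : List (Fin 2)} (hinf : {k | OccursAt w k}.Infinite) :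
    ((returnWord w 0).length : ℤ) = position w 1 - 1 := by
  have hpos : 1 ≤ position w 1 := (Nat.nth_mem_of_infinite hinf 0).1
  rw [returnWord, length_factor]
  omega

theorem length_returnWord_succ {w : List (Fin 2)} (hinf : {k | OccursAt w k}.Infinite) (n : ℕ) :
    ((returnWord w (n + 1)).length : ℤ) = position w (n + 2) - position w (n + 1) := by
  have hlt : position w (n + 1) < position w (n + 2) := Nat.nth_strictMono hinf n.lt_succ_self
  rw [returnWord, length_factor]
  omega

end FibReturn

theorem mainTheorem10 (w : List (Fin 2)) (hw : w ∈ FibReturn.language) :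
    {k : ℕ | FibReturn.OccursAt w k}.Infinite ∧
    ∀ l₀ l₁ l₂ : ℤ,
      l₀ = (FibReturn.returnWord w 0).length →
      l₁ = (FibReturn.returnWord w 1).length →
      l₂ = (FibReturn.returnWord w 2).length →
      FibReturn.IsGeneralizedBeatty Real.goldenRatio (l₁ - l₂) (2 * l₂ - l₁) (l₀ + 1 - l₂)
        (fun n => (FibReturn.position w n : ℤ)) := by
  have hinf := FibReturn.infinite_setOf_occursAt hw
  obtain ⟨p, q, r, hbeatty⟩ := FibReturn.exists_isGeneralizedBeatty_position hw
  refine ⟨hinf, ?_⟩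
  rintro _ _ _ rfl rfl rfl
  obtain ⟨rfl, rfl, rfl⟩ := hbeatty.coefficients_eq
  rw [FibReturn.length_returnWord_zero hinf, FibReturn.length_returnWord_succ hinf,
    FibReturn.length_returnWord_succ hinf, sub_add_cancel]
  exact hbeatty
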